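/- Let $S\subseteq\mathbb N$ be a numerical semigroup (a cofinite additive submonoid), let $m\in S$ be nonzero (for instance the multiplicity of $S$), and write $S=\langle m,n_1,\dots,n_k\rangle$ where no $n_i$ lies in the monoid generated by $m$ and the other $n_j$. Let $\varphi_S:\mathbb N^{k+1}\to S$, $\varphi_S(z_0,\dots,z_k)=z_0m+z_1n_1+\cdots+z_kn_k$, and put $\widehat z=(z_1,\dots,z_k)$ for $z=(z_0,\dots,z_k)$. For a homomorphism $\varphi$ of commutative monoids defined on $\mathbb N^d$, a *presentation* of $\ker\varphi=\{(z,z'):\varphi(z)=\varphi(z')\}$ is a set $\rho\subseteq\mathbb N^d\times\mathbb N^d$ such that $\ker\varphi$ is the smallest congruence on $\mathbb N^d$ containing $\rho$; it is *minimal* if no proper subset of it is a presentation. A *minimal presentation of $S$* is a minimal presentation of $\ker\varphi_S$. Let $\mathrm{Ap}(S;m)=\{a\in S: a-m\notin S\}$, ordered by $a\preceq a'$ iff $a'-a\in\mathrm{Ap}(S;m)$. The *Kunz poset* $P$ of $S$ is the poset on $\mathbb Z/m\mathbb Z$ obtained by replacing each element of $\mathrm{Ap}(S;m)$ by its class modulo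 $m$. Its *Kunz nilsemigroup* is $N=P\cup\{\infty\}$, where $\infty$ is absorbing and, for $a,b\in P$, $a\oplus b=a+b$ if $a\preceq a+b$ in $P$ and $a\oplus b=\infty$ otherwise. Let $p_i=n_i \bmod m$ (these are the atoms of $P$), let $\varphi_P:\mathbb N^k\to N$ be $\varphi_P(z)=z_1p_1\oplus\cdots\oplus z_kp_k$, and let $\mathsf Z_P(x)=\varphi_P^{-1}(x)$ for $x\in N$. A *minimal presentation of $P$* is a set of the form $\{(z,z')\in\sigma:\varphi_P(z)\neq\infty\}$, where $\sigma$ is a minimal presentation of $\ker\varphi_P$. An *outer Betti element* of $P$ is a nonempty set $B\subseteq\mathsf Z_P(\infty)$ such that (i) for each $i$ for which some $z\in B$ has $z_i>0$, the set $\{z-e_i: z\in B,\ z_i>0\}$ equals $\mathsf Z_P(p)$ for some $p\in P$, and (ii) the graph on $B$ joining two distinct tuples whenever some coordinate is positive in both is connected. A minimal presentation $\rho$ of $S$ is *$m$-centric* if $\widehat z\in\mathsf Z_P(\overline z)$ for every $(z,z')\in\rho$, where $\overline z=z_1p_1+\cdots+z_kp_k\in\mathbb Z/m\mathbb Z$.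 **Theorem.** Let $\rho$ be an $m$-centric minimal presentation of $S$. Then: (a) the set $\{(\widehat z,\widehat{z'}):(z,z')\in\rho,\ z_0=0\}$ is a minimal presentation of $P$; (b) the set $T=\{\widehat{z'}:(z,z')\in\rho,\ z_0>0\}$ consists of exactly one factorization from each outer Betti element of $P$: every element of $T$ lies in exactly one outer Betti element of $P$, and every outer Betti element of $P$ contains exactly one element of $T$. -/

import Mathlib

/-! ### Factorizations and presentations of commutative monoids -/

/-- The factorization homomorphism `z ↦ z₁ g₁ + ⋯ + z_d g_d` attached to a list of generators. -/
def factHom {d : ℕ} {M : Type*} [AddCommMonoid M] (g : Fin d → M) : (Fin d → ℕ) →+ M where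
  toFun z := ∑ i, z i • g i
  map_zero' := by simp
  map_add' z z' := by simp [add_smul, Finset.sum_add_distrib]

/-- The set `Z(x)` of factorizations of `x`. -/
def factSet {d : ℕ} {M : Type*} [AddCommMonoid M] (g : Fin d → M) (x : M) : Set (Fin d → ℕ) :=
  {z | factHom g z = x}

/-- `ρ` is a presentation: the kernel of the factorization homomorphism is the smallest
congruence on `ℕ^d` containing `ρ`. -/
def IsPresentation {d : ℕ} {M : Type*} [AddCommMonoid M] (g : Fin d → M)
    (ρ : Set ((Fin d → ℕ) × (Fin d → ℕ))) : Prop :=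
  addConGen (fun z z' => (z, z') ∈ ρ) = AddCon.ker (factHom g)

/-- A minimal presentation: minimal with respect to containment among all presentations. -/
def IsMinimalPresentation {d : ℕ} {M : Type*} [AddCommMonoid M] (g : Fin d → M)
    (ρ : Set ((Fin d → ℕ) × (Fin d → ℕ))) : Prop :=
  Minimal (IsPresentation g) ρ

/-- The factorization graph of `Z ⊆ ℕ^d`: distinct tuples are adjacent when some coordinate is
positive in both. -/
def factGraph {d : ℕ} (Z : Set (Fin d → ℕ)) : SimpleGraph Z where
  Adj z z' := z ≠ z' ∧ ∃ i, 0 < z.1 i ∧ 0 < z'.1 i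
  symm := ⟨fun _ _ h => ⟨h.1.symm, h.2.imp fun _ hi => hi.symm⟩⟩
  loopless := ⟨fun _ h => h.1 rfl⟩

/-! ### Nilsemigroups (with nil element `⊤`) -/

/-- The set `B - e_i = {z - e_i : z ∈ B, z_i > 0}`. -/
def subE {d : ℕ} (B : Set (Fin d → ℕ)) (i : Fin d) : Set (Fin d → ℕ) :=
  {w | w + Pi.single i 1 ∈ B}

/-- Outer Betti elements of a nilsemigroup `N` with atoms `p₁, …, p_k` and nil `⊤`.
Connectedness of a graph includes that it has a vertex, so `B` is non-empty. -/
structure IsOuterBetti {k : ℕ} {N : Type*} [AddCommMonoid N] [Top N] (p : Fin k → N)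
    (B : Set (Fin k → ℕ)) : Prop where
  subset_nil : B ⊆ factSet p ⊤
  sub_eq : ∀ i : Fin k, (∃ z ∈ B, 0 < z i) → ∃ x : N, x ≠ ⊤ ∧ subE B i = factSet p x
  connected : (factGraph B).Connected

/-- A minimal presentation in the sense of Kunz posets: take a minimal generating set of the
kernel congruence of the nilsemigroup, and omit all relations between factorizations of `⊤`. -/
def IsMinimalNilPresentation {k : ℕ} {N : Type*} [AddCommMonoid N] [Top N] (p : Fin k → N)
    (ρ : Set ((Fin k → ℕ) × (Fin k → ℕ))) : Prop :=
  ∃ σ, IsMinimalPresentation p σ ∧ ρ = {r ∈ σ | factHom p r.1 ≠ ⊤}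

/-! ### Numerical semigroups, Apéry sets, Kunz posets and Kunz nilsemigroups -/

/-- `S` is a numerical semigroup, and `m` is a nonzero element of it. -/
structure IsNumerical (S : AddSubmonoid ℕ) (m : ℕ) : Prop where
  finite_compl : ((S : Set ℕ)ᶜ).Finite
  mem : m ∈ S
  ne_zero : m ≠ 0

/-- The Apéry set `{x ∈ S : x - m ∉ S}`. -/
def aperySet (S : AddSubmonoid ℕ) (m : ℕ) : Set ℕ :=
  {x | x ∈ S ∧ ¬ ∃ y ∈ S, y + m = x}

/-- The Apéry poset (`a ⪯ a'` iff `a' - a` is in the Apéry set), transported to `ℤ/m`. -/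
def KunzLE (S : AddSubmonoid ℕ) (m : ℕ) (i j : ZMod m) : Prop :=
  ∃ a ∈ aperySet S m, ∃ a' ∈ aperySet S m,
    (a : ZMod m) = i ∧ (a' : ZMod m) = j ∧ ∃ c ∈ aperySet S m, a + c = a'

namespace IsNumerical

variable {S : AddSubmonoid ℕ} {m : ℕ}

lemma exists_mem_class (h : IsNumerical S m) (i : ZMod m) : ∃ x ∈ S, (x : ZMod m) = i := by
  have : NeZero m := ⟨h.ne_zero⟩
  obtain ⟨b, hb⟩ := h.finite_compl.bddAbove
  refine ⟨i.val + m * (b + 1), ?_, by simp⟩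
  by_contra hx
  have h1 := hb (show i.val + m * (b + 1) ∈ ((S : Set ℕ)ᶜ) from hx)
  have h2 : 1 * (b + 1) ≤ m * (b + 1) :=
    Nat.mul_le_mul_right _ (Nat.one_le_iff_ne_zero.mpr h.ne_zero)
  omega

lemma exists_apery (h : IsNumerical S m) (i : ZMod m) :
    ∃ a ∈ aperySet S m, (a : ZMod m) = i := by
  classical
  have hex := h.exists_mem_class i
  refine ⟨Nat.find hex, ⟨(Nat.find_spec hex).1, ?_⟩, (Nat.find_spec hex).2⟩
  rintro ⟨y, hy, hym⟩
  have hlt : y < Nat.find hex := by have := h.ne_zero; omega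
  refine Nat.find_min hex hlt ⟨hy, ?_⟩
  have := (Nat.find_spec hex).2
  rw [← hym] at this
  simpa using this

/-- An Apéry element is the least element of `S` in its class. -/
lemma apery_le (h : IsNumerical S m) {a x : ℕ} (ha : a ∈ aperySet S m) (hx : x ∈ S)
    (hax : (a : ZMod m) = x) : a ≤ x := by
  by_contra hlt
  rw [not_le] at hlt
  have hmod : x ≡ a [MOD m] := ((ZMod.natCast_eq_natCast_iff _ _ _).1 hax).symm
  obtain ⟨t, ht⟩ := (Nat.modEq_iff_dvd' hlt.le).1 hmod
  obtain _ | t := t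
  · simp at ht; omega
  · refine ha.2 ⟨x + t • m, S.add_mem hx (S.nsmul_mem h.mem t), ?_⟩
    have : m * (t + 1) = t * m + m := by ring
    simp only [smul_eq_mul]
    omega

lemma apery_unique (h : IsNumerical S m) {a b : ℕ} (ha : a ∈ aperySet S m)
    (hb : b ∈ aperySet S m) (hab : (a : ZMod m) = b) : a = b :=
  le_antisymm (h.apery_le ha hb.1 hab) (h.apery_le hb ha.1 hab.symm)

/-- The Apéry element in a given class. -/
noncomputable def ap (h : IsNumerical S m) (i : ZMod m) : ℕ := (h.exists_apery i).choose

lemma ap_mem (h : IsNumerical S m) (i : ZMod m) : h.ap i ∈ aperySet S m :=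
  (h.exists_apery i).choose_spec.1

lemma ap_cast (h : IsNumerical S m) (i : ZMod m) : (h.ap i : ZMod m) = i :=
  (h.exists_apery i).choose_spec.2

lemma zero_mem_apery (h : IsNumerical S m) : 0 ∈ aperySet S m :=
  ⟨S.zero_mem, by rintro ⟨y, _, hy⟩; have := h.ne_zero; omega⟩

lemma ap_zero (h : IsNumerical S m) : h.ap 0 = 0 :=
  h.apery_unique (h.ap_mem 0) h.zero_mem_apery (by rw [h.ap_cast]; simp)

lemma ap_add_le (h : IsNumerical S m) (i j : ZMod m) : h.ap (i + j) ≤ h.ap i + h.ap j :=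
  h.apery_le (h.ap_mem _) (S.add_mem (h.ap_mem i).1 (h.ap_mem j).1)
    (by simp [h.ap_cast])

lemma kunzLE_add_iff (h : IsNumerical S m) (i j : ZMod m) :
    KunzLE S m i (i + j) ↔ h.ap i + h.ap j = h.ap (i + j) := by
  constructor
  · rintro ⟨a, ha, a', ha', hi, hj, c, hc, hac⟩
    have e1 := h.apery_unique ha (h.ap_mem i) (by rw [hi, h.ap_cast])
    have e2 := h.apery_unique ha' (h.ap_mem (i + j)) (by rw [hj, h.ap_cast])
    have e3 : c = h.ap j := by
      refine h.apery_unique hc (h.ap_mem j) ?_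
      rw [h.ap_cast]
      have : ((a + c : ℕ) : ZMod m) = i + j := by rw [hac, hj]
      rw [Nat.cast_add, hi] at this
      exact add_left_cancel this
    rw [← e1, ← e2, ← e3, hac]
  · intro e
    exact ⟨_, h.ap_mem i, _, h.ap_mem (i + j), h.ap_cast _, h.ap_cast _, _, h.ap_mem j, e⟩

lemma kunzLE_iff (h : IsNumerical S m) (i j : ZMod m) :
    KunzLE S m i j ↔ h.ap i + h.ap (j - i) = h.ap j := by
  have := h.kunzLE_add_iff i (j - i)
  rwa [add_sub_cancel] at this

/-- The Kunz poset of `S`, a partial order on `ℤ/m`. -/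
abbrev kunzPoset (h : IsNumerical S m) : PartialOrder (ZMod m) where
  le := KunzLE S m
  le_refl i := by rw [h.kunzLE_iff]; simp [h.ap_zero]
  le_trans i j l hij hjl := by
    rw [h.kunzLE_iff] at *
    have h1 := h.ap_add_le (j - i) (l - j)
    have h2 := h.ap_add_le i (l - i)
    rw [show j - i + (l - j) = l - i by ring] at h1
    rw [add_sub_cancel] at h2
    omega
  le_antisymm i j hij hji := by
    rw [h.kunzLE_iff] at *
    have : h.ap i = h.ap j := by omega
    rw [← h.ap_cast i, this, h.ap_cast]

end IsNumerical

/-- The underlying set `P ∪ {∞}` of the Kunz nilsemigroup of `S`. -/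
def KunzNil {S : AddSubmonoid ℕ} {m : ℕ} (_h : IsNumerical S m) : Type := WithTop (ZMod m)

namespace KunzNil

variable {S : AddSubmonoid ℕ} {m : ℕ}

/-- The inclusion of the Kunz poset `P` into `N = P ∪ {∞}`. -/
def of (h : IsNumerical S m) (i : ZMod m) : KunzNil h := (WithTop.some i : WithTop (ZMod m))

/-- The nil `∞`. -/
instance (h : IsNumerical S m) : Top (KunzNil h) := ⟨(⊤ : WithTop (ZMod m))⟩

/-- The operation of the Kunz nilsemigroup: for `i, j ∈ P`, the sum is `i + j` if
`i ⪯ i + j` in the Kunz poset, and `∞` otherwise; and `∞` is a nil. -/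
noncomputable def add (h : IsNumerical S m) : KunzNil h → KunzNil h → KunzNil h :=
  open Classical in fun x y =>
  match (x : WithTop (ZMod m)), (y : WithTop (ZMod m)) with
  | WithTop.some i, WithTop.some j => if h.kunzPoset.le i (i + j) then of h (i + j) else ⊤
  | _, _ => ⊤

noncomputable instance (h : IsNumerical S m) : Add (KunzNil h) := ⟨add h⟩

instance (h : IsNumerical S m) : Zero (KunzNil h) := ⟨of h 0⟩

lemma cases (h : IsNumerical S m) (x : KunzNil h) : x = ⊤ ∨ ∃ i, x = of h i := by
  rcases (x : WithTop (ZMod m)) with _ | i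
  · exact Or.inl rfl
  · exact Or.inr ⟨i, rfl⟩

lemma top_add (h : IsNumerical S m) (x : KunzNil h) : ⊤ + x = ⊤ := rfl

lemma add_top (h : IsNumerical S m) (x : KunzNil h) : x + ⊤ = ⊤ := by
  rcases cases h x with rfl | ⟨i, rfl⟩ <;> rfl

open Classical in
lemma of_add_of (h : IsNumerical S m) (i j : ZMod m) :
    of h i + of h j = if h.ap i + h.ap j = h.ap (i + j) then of h (i + j) else ⊤ := by
  change (if KunzLE S m i (i + j) then of h (i + j) else ⊤) = _
  simp only [h.kunzLE_add_iff]

noncomputable instance (h : IsNumerical S m) : AddCommMonoid (KunzNil h) where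
  add_assoc x y z := by
    classical
    rcases cases h x with rfl | ⟨i, rfl⟩
    · simp [top_add]
    rcases cases h y with rfl | ⟨j, rfl⟩
    · simp [top_add, add_top]
    rcases cases h z with rfl | ⟨l, rfl⟩
    · simp [add_top]
    have h1 := h.ap_add_le i j
    have h2 := h.ap_add_le j l
    have h3 := h.ap_add_le (i + j) l
    have h4 := h.ap_add_le i (j + l)
    rw [add_assoc] at h3
    rw [of_add_of, of_add_of]
    by_cases c1 : h.ap i + h.ap j = h.ap (i + j) <;>
      by_cases c2 : h.ap j + h.ap l = h.ap (j + l) <;>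
      simp only [c1, c2, if_true, if_false, of_add_of, top_add, add_top, add_assoc]
    · congr 1
      rw [eq_iff_iff]
      omega
    · rw [if_neg]; omega
    · rw [if_neg]; omega
  zero_add x := by
    rcases cases h x with rfl | ⟨i, rfl⟩
    · exact add_top h _
    · change of h 0 + of h i = _
      rw [of_add_of]; simp [h.ap_zero]
  add_zero x := by
    rcases cases h x with rfl | ⟨i, rfl⟩
    · rfl
    · change of h i + of h 0 = _
      rw [of_add_of]; simp [h.ap_zero]
  add_comm x y := by
    rcases cases h x with rfl | ⟨i, rfl⟩
    · rw [top_add, add_top]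
    rcases cases h y with rfl | ⟨j, rfl⟩
    · rw [top_add, add_top]
    rw [of_add_of, of_add_of, add_comm i j, add_comm (h.ap i)]
  nsmul := nsmulRec

end KunzNil

/-- The generators `m, n₁, …, n_k` of `S`, in this order; the index `0` belongs to `m`. -/
def gens {k : ℕ} (m : ℕ) (n : Fin k → ℕ) : Fin (k + 1) → ℕ := Fin.cons m n

/-- The atoms `p_i = n_i mod m` of the Kunz poset, as elements of the Kunz nilsemigroup. -/
def kunzAtoms {S : AddSubmonoid ℕ} {m k : ℕ} (h : IsNumerical S m) (n : Fin k → ℕ) :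
    Fin k → KunzNil h :=
  fun i => KunzNil.of h (n i : ZMod m)

/-- `ẑ`: drop the coordinate of `m`. -/
def hat {k : ℕ} (z : Fin (k + 1) → ℕ) : Fin k → ℕ := Fin.tail z

/-- `ẑ` is a factorization, in the Kunz poset, of `z̄ = z₁ p₁ + ⋯ + z_k p_k ∈ ℤ/m`
for every relation `(z, z')` in `ρ`. -/
def IsMCentric {S : AddSubmonoid ℕ} {m k : ℕ} (h : IsNumerical S m) (n : Fin k → ℕ)
    (ρ : Set ((Fin (k + 1) → ℕ) × (Fin (k + 1) → ℕ))) : Prop :=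
  ∀ r ∈ ρ, hat r.1 ∈
    factSet (kunzAtoms h n) (KunzNil.of h (factHom (fun i => (n i : ZMod m)) (hat r.1)))

/-! ### Congruences and irredundant presentations -/

lemma AddCon.rel_of_addConGen {M : Type*} [Add M] {r R : M → M → Prop}
    (hR : Equivalence R) (hadd : ∀ {w x y z}, R w x → R y z → R (w + y) (x + z))
    (hr : ∀ x y, r x y → R x y) {x y : M} (h : addConGen r x y) : R x y := by
  let c : AddCon M := { r := R, iseqv := hR, add' := hadd }
  exact AddCon.addConGen_le.2 (show ∀ x y, r x y → c x y from hr) h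

lemma addConGen_of_rel {M : Type*} [Add M] {r : M → M → Prop} {x y : M} (h : r x y) :
    addConGen r x y := AddConGen.Rel.of _ _ h

lemma addConGen_mono_rel {M : Type*} [Add M] {r s : M → M → Prop} (h : ∀ x y, r x y → s x y)
    {x y : M} (hxy : addConGen r x y) : addConGen s x y :=
  AddCon.addConGen_mono h hxy

section Presentation

variable {d : ℕ} {M : Type*} [AddCommMonoid M] {g : Fin d → M}
  {ρ : Set ((Fin d → ℕ) × (Fin d → ℕ))}

lemma isPresentation_iff : IsPresentation g ρ ↔
    ∀ z z', addConGen (fun z z' => (z, z') ∈ ρ) z z' ↔ factHom g z = factHom g z' :=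
  AddCon.ext_iff

lemma IsPresentation.factHom_eq (h : IsPresentation g ρ) {z z' : Fin d → ℕ}
    (hz : (z, z') ∈ ρ) : factHom g z = factHom g z' :=
  (isPresentation_iff.1 h z z').1 (addConGen_of_rel hz)

lemma isMinimalPresentation_iff : IsMinimalPresentation g ρ ↔ IsPresentation g ρ ∧
    ∀ r ∈ ρ, ¬ addConGen (fun z z' => (z, z') ∈ ρ \ {r}) r.1 r.2 := by
  refine ⟨fun h => ⟨h.prop, fun r hr hgen => ?_⟩, fun h => ⟨h.1, fun τ hτ hle r hr => ?_⟩⟩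
  · refine (h.le_of_le (y := ρ \ {r}) ?_ Set.sdiff_subset hr).2 rfl
    refine le_antisymm ?_ ?_
    · rw [← h.prop]
      exact AddCon.addConGen_mono fun x y hxy => hxy.1
    · rw [← h.prop]
      refine AddCon.addConGen_le.2 fun x y hxy => ?_
      by_cases hx : (x, y) = r
      · subst hx; exact hgen
      · exact addConGen_of_rel ⟨hxy, hx⟩
  · by_contra hn
    refine h.2 r hr (addConGen_mono_rel (r := fun z z' => (z, z') ∈ τ) ?_ ?_)
    · exact fun x y hxy => ⟨hle hxy, by rintro rfl; exact hn hxy⟩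
    · exact (isPresentation_iff.1 hτ _ _).2 (h.1.factHom_eq hr)

lemma factHom_single (g : Fin d → M) (i : Fin d) : factHom g (Pi.single i 1) = g i := by
  simp [factHom, Pi.single_apply, ite_smul]

lemma exists_eq_add_single {z : Fin d → ℕ} {i : Fin d} (h : 0 < z i) :
    ∃ u : Fin d → ℕ, z = u + Pi.single i 1 :=
  ⟨z - Pi.single i 1, by
    funext j
    by_cases hj : j = i
    · subst hj; simp; omega
    · simp [hj]⟩

lemma mem_closure_range_iff {x : M} :
    x ∈ AddSubmonoid.closure (Set.range g) ↔ ∃ z, factHom g z = x := by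
  refine ⟨fun h => ?_, ?_⟩
  · induction h using AddSubmonoid.closure_induction with
    | mem x hx => obtain ⟨i, rfl⟩ := hx; exact ⟨_, factHom_single g i⟩
    | zero => exact ⟨0, map_zero (factHom g)⟩
    | add x y _ _ hx hy =>
      obtain ⟨z, rfl⟩ := hx
      obtain ⟨w, rfl⟩ := hy
      exact ⟨z + w, map_add (factHom g) z w⟩
  · rintro ⟨z, rfl⟩
    exact AddSubmonoid.sum_mem (t := Finset.univ) (f := fun i => z i • g i) _ fun i _ =>
      AddSubmonoid.nsmul_mem _ (AddSubmonoid.subset_closure (Set.mem_range_self i)) _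

/-- The fibre over an absorbing element is generated, as a single congruence class, by finitely
many relations. -/
lemma exists_finite_generating_fiber (g : Fin d → M) {t : M} (ht : ∀ x, t + x = t) :
    ∃ F : Set ((Fin d → ℕ) × (Fin d → ℕ)), F.Finite ∧
      (∀ r ∈ F, factHom g r.1 = t ∧ factHom g r.2 = t) ∧
      ∀ z z', factHom g z = t → factHom g z' = t →
        addConGen (fun z z' => (z, z') ∈ F) z z' := by
  by_cases hne : ∃ w, factHom g w = t
  swap
  · exact ⟨∅, Set.finite_empty, by simp, fun z _ hz => absurd ⟨z, hz⟩ hne⟩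
  obtain ⟨w, hw⟩ := hne
  have hfin : {v | Minimal (fun v => factHom g v = t) v}.Finite :=
    WellQuasiOrderedLE.finite_of_isAntichain (setOfPred_minimal_antichain _)
  set F : Set ((Fin d → ℕ) × (Fin d → ℕ)) :=
    (Prod.mk w) '' {v | Minimal (fun v => factHom g v = t) v} ∪
      Set.range fun i : Fin d => (w, w + Pi.single i 1) with hF
  have hshift : ∀ u, addConGen (fun z z' => (z, z') ∈ F) w (w + u) := by
    intro u
    have : u ∈ AddSubmonoid.closure (Set.range fun i : Fin d => Pi.single (M := fun _ => ℕ) i 1) :=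
      mem_closure_range_iff.2 ⟨u, by
        simp only [factHom, AddMonoidHom.coe_mk, ZeroHom.coe_mk]
        funext j
        simp [Finset.sum_apply, Pi.single_apply]⟩
    induction this using AddSubmonoid.closure_induction with
    | mem x hx =>
      obtain ⟨i, rfl⟩ := hx
      exact addConGen_of_rel (Or.inr ⟨i, rfl⟩)
    | zero => rw [add_zero]; exact AddCon.refl _ _
    | add x y _ _ hx hy =>
      rw [← add_assoc]
      exact AddCon.trans _ hy (AddCon.add _ hx (AddCon.refl _ y))
  have hall : ∀ z, factHom g z = t → addConGen (fun z z' => (z, z') ∈ F) w z := by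
    intro z hz
    obtain ⟨v, hvz, hv⟩ := exists_minimal_le_of_wellFoundedLT (fun v => factHom g v = t) z hz
    obtain ⟨u, rfl⟩ := exists_add_of_le hvz
    have hwv : addConGen (fun z z' => (z, z') ∈ F) w v :=
      addConGen_of_rel (Or.inl ⟨v, hv, rfl⟩)
    exact AddCon.trans _ (hshift u) (AddCon.add _ hwv (AddCon.refl _ u))
  refine ⟨F, (hfin.image _).union (Set.finite_range _), ?_, fun z z' hz hz' =>
    AddCon.trans _ (AddCon.symm _ (hall z hz)) (hall z' hz')⟩
  rintro r (⟨v, hv, rfl⟩ | ⟨i, rfl⟩)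
  · exact ⟨hw, Minimal.prop (P := fun v => factHom g v = t) hv⟩
  · exact ⟨hw, by simp only [map_add, hw, ht]⟩

end Presentation

/-! ### Relations of bounded degree -/

section Degree

variable {d : ℕ} {g : Fin d → ℕ} {ρ : Set ((Fin d → ℕ) × (Fin d → ℕ))}

/-- The congruence generated by the relations of `ρ` in degrees below `a`. -/
def conBelow (g : Fin d → ℕ) (ρ : Set ((Fin d → ℕ) × (Fin d → ℕ))) (a : ℕ) :
    AddCon (Fin d → ℕ) :=
  addConGen fun z z' => (z, z') ∈ ρ ∧ factHom g z < a

lemma conBelow_mono {a b : ℕ} (hab : a ≤ b) {z z' : Fin d → ℕ} (h : conBelow g ρ a z z') :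
    conBelow g ρ b z z' :=
  addConGen_mono_rel (fun _ _ hxy => ⟨hxy.1, hxy.2.trans_le hab⟩) h

lemma IsPresentation.conBelow_succ (hρ : IsPresentation g ρ) {z z' : Fin d → ℕ}
    (h : factHom g z = factHom g z') : conBelow g ρ (factHom g z + 1) z z' := by
  have hgen := (isPresentation_iff.1 hρ z z').2 h
  refine (AddCon.rel_of_addConGen
    (R := fun z z' => factHom g z = factHom g z' ∧ conBelow g ρ (factHom g z + 1) z z')
    ⟨fun z => ⟨rfl, AddCon.refl _ _⟩, fun h => ⟨h.1.symm, ?_⟩, fun h h' => ⟨h.1.trans h'.1, ?_⟩⟩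
    ?_ ?_ hgen).2
  · rw [← h.1]; exact AddCon.symm _ h.2
  · exact AddCon.trans _ h.2 (by rw [h.1]; exact h'.2)
  · intro w x y z h h'
    refine ⟨by rw [map_add, map_add, h.1, h'.1], AddCon.add _ ?_ ?_⟩
    · exact conBelow_mono (by rw [map_add]; omega) h.2
    · exact conBelow_mono (by rw [map_add]; omega) h'.2
  · exact fun x y hxy => ⟨hρ.factHom_eq hxy, addConGen_of_rel ⟨hxy, by omega⟩⟩

/-- Two factorizations with a common generator are related by relations of lower degree. -/
lemma IsPresentation.conBelow_of_pos (hρ : IsPresentation g ρ) (hg : ∀ i, g i ≠ 0)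
    {z z' : Fin d → ℕ} (h : factHom g z = factHom g z') {i : Fin d} (hz : 0 < z i)
    (hz' : 0 < z' i) : conBelow g ρ (factHom g z) z z' := by
  obtain ⟨u, rfl⟩ := exists_eq_add_single hz
  obtain ⟨u', rfl⟩ := exists_eq_add_single hz'
  simp only [map_add, factHom_single, add_left_inj] at h ⊢
  exact AddCon.add _ (conBelow_mono (by have := hg i; omega) (hρ.conBelow_succ h))
    (AddCon.refl _ _)

lemma conBelow_sdiff {r : (Fin d → ℕ) × (Fin d → ℕ)} {a : ℕ} (hr : a ≤ factHom g r.1)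
    {z z' : Fin d → ℕ} (h : conBelow g ρ a z z') :
    addConGen (fun z z' => (z, z') ∈ ρ \ {r}) z z' :=
  addConGen_mono_rel (fun x y hxy => ⟨hxy.1, by
    rintro rfl; exact absurd hxy.2 (not_lt.2 hr)⟩) h

end Degree

/-! ### Generators and Apéry sets -/

section Gens

variable {k m : ℕ} {n : Fin k → ℕ}

lemma factHom_gens (z : Fin (k + 1) → ℕ) :
    factHom (gens m n) z = z 0 * m + factHom n (hat z) := by
  simp [factHom, gens, hat, Fin.sum_univ_succ, Fin.tail]

@[simp] lemma hat_cons (a : ℕ) (w : Fin k → ℕ) : hat (Fin.cons a w : Fin (k + 1) → ℕ) = w :=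
  Fin.tail_cons _ _

lemma cons_hat {z : Fin (k + 1) → ℕ} (hz : z 0 = 0) :
    (Fin.cons 0 (hat z) : Fin (k + 1) → ℕ) = z := by
  rw [← hz]; exact Fin.cons_self_tail z

lemma cons_zero_add (w w' : Fin k → ℕ) :
    (Fin.cons 0 (w + w') : Fin (k + 1) → ℕ) = Fin.cons 0 w + Fin.cons 0 w' := by
  funext i; cases i using Fin.cases <;> simp

@[simp] lemma factHom_gens_cons_zero (w : Fin k → ℕ) :
    factHom (gens m n) (Fin.cons 0 w : Fin (k + 1) → ℕ) = factHom n w := by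
  simp [factHom_gens]

variable {S : AddSubmonoid ℕ}

lemma mem_iff_exists_factHom (hgen : AddSubmonoid.closure (Set.range (gens m n)) = S) {x : ℕ} :
    x ∈ S ↔ ∃ z, factHom (gens m n) z = x := by
  rw [← hgen]; exact mem_closure_range_iff

lemma factHom_mem (hgen : AddSubmonoid.closure (Set.range (gens m n)) = S)
    (w : Fin k → ℕ) : factHom n w ∈ S :=
  (mem_iff_exists_factHom hgen).2 ⟨Fin.cons 0 w, factHom_gens_cons_zero w⟩

lemma ne_zero_of_notMem_closure
    (hmin : ∀ i : Fin k, n i ∉ AddSubmonoid.closure (insert m (n '' {j | j ≠ i}))) (i : Fin k) :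
    n i ≠ 0 := by
  intro h0
  refine hmin i ?_
  rw [h0]; exact zero_mem _

lemma gens_ne_zero (hm : m ≠ 0) (hn : ∀ i, n i ≠ 0) (i : Fin (k + 1)) : gens m n i ≠ 0 := by
  cases i using Fin.cases with
  | zero => simpa [gens] using hm
  | succ i => simpa [gens] using hn i

lemma gen_mem_aperySet (hm : m ≠ 0) (hgen : AddSubmonoid.closure (Set.range (gens m n)) = S)
    (hmin : ∀ i : Fin k, n i ∉ AddSubmonoid.closure (insert m (n '' {j | j ≠ i}))) (i : Fin k) :
    n i ∈ aperySet S m := by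
  refine ⟨by simpa [factHom_single] using factHom_mem hgen (Pi.single i 1), ?_⟩
  rintro ⟨y, hy, hym⟩
  obtain ⟨z, rfl⟩ := (mem_iff_exists_factHom hgen).1 hy
  have hm' : m ∈ AddSubmonoid.closure (insert m (n '' {j | j ≠ i})) :=
    AddSubmonoid.subset_closure (Set.mem_insert _ _)
  have hzi : hat z i = 0 := by
    by_contra hne
    obtain ⟨u, hu⟩ := exists_eq_add_single (Nat.pos_of_ne_zero hne)
    rw [factHom_gens, hu, map_add, factHom_single] at hym
    omega
  refine hmin i ?_
  rw [← hym, factHom_gens]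
  refine add_mem (add_mem (AddSubmonoid.nsmul_mem _ hm' _) ?_) hm'
  refine AddSubmonoid.sum_mem (t := Finset.univ) (f := fun j => hat z j • n j) _ fun j _ => ?_
  by_cases hj : j = i
  · rw [hj, hzi, zero_smul]; exact zero_mem _
  · exact AddSubmonoid.nsmul_mem _
      (AddSubmonoid.subset_closure (Set.mem_insert_of_mem _ (Set.mem_image_of_mem n hj))) _

lemma aperySet.of_add_left {a b : ℕ} (ha : a ∈ S) (hb : b ∈ S) (hab : a + b ∈ aperySet S m) :
    a ∈ aperySet S m :=
  ⟨ha, fun ⟨y, hy, h⟩ => hab.2 ⟨y + b, S.add_mem hy hb, by omega⟩⟩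

lemma aperySet.of_add_right {a b : ℕ} (ha : a ∈ S) (hb : b ∈ S) (hab : a + b ∈ aperySet S m) :
    b ∈ aperySet S m :=
  aperySet.of_add_left hb ha (by rwa [add_comm])

lemma apply_zero_eq_zero_of_mem_aperySet
    (hgen : AddSubmonoid.closure (Set.range (gens m n)) = S) {z : Fin (k + 1) → ℕ}
    (hz : factHom (gens m n) z ∈ aperySet S m) : z 0 = 0 := by
  by_contra hne
  obtain ⟨u, rfl⟩ := exists_eq_add_single (Nat.pos_of_ne_zero hne)
  refine hz.2 ⟨factHom (gens m n) u, (mem_iff_exists_factHom hgen).2 ⟨u, rfl⟩, ?_⟩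
  rw [map_add, factHom_single]
  rfl

/-- An element of `S` outside of the Apéry set has a factorization involving `m`. -/
lemma exists_factHom_eq_of_notMem_aperySet
    (hgen : AddSubmonoid.closure (Set.range (gens m n)) = S) {a : ℕ} (ha : a ∈ S)
    (ha' : a ∉ aperySet S m) : ∃ u, factHom (gens m n) u = a ∧ 0 < u 0 := by
  have : ∃ y ∈ S, y + m = a := by
    by_contra hne
    exact ha' ⟨ha, hne⟩
  obtain ⟨y, hy, rfl⟩ := this
  obtain ⟨u, rfl⟩ := (mem_iff_exists_factHom hgen).1 hy
  exact ⟨u + Pi.single 0 1, by rw [map_add, factHom_single]; rfl, by simp⟩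

end Gens

/-! ### Factorizations in the Kunz nilsemigroup -/

namespace KunzNil

variable {S : AddSubmonoid ℕ} {m : ℕ} (h : IsNumerical S m)

lemma of_ne_top (i : ZMod m) : of h i ≠ ⊤ := fun e => WithTop.coe_ne_top e

lemma of_injective : Function.Injective (of h) := fun _ _ e => WithTop.coe_injective e

open Classical in
/-- The projection of `S` onto its Kunz nilsemigroup, collapsing the complement of the Apéry
set. -/
noncomputable def proj : S →+ KunzNil h where
  toFun x := if (x : ℕ) ∈ aperySet S m then of h ((x : ℕ) : ZMod m) else ⊤
  map_zero' := by
    rw [if_pos (by exact h.zero_mem_apery)]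
    simp; rfl
  map_add' x y := by
    by_cases hx : (x : ℕ) ∈ aperySet S m
    swap
    · rw [if_neg hx, top_add, if_neg]
      exact fun hxy => hx (aperySet.of_add_left x.2 y.2 hxy)
    by_cases hy : (y : ℕ) ∈ aperySet S m
    swap
    · rw [if_neg hy, add_top, if_neg]
      exact fun hxy => hy (aperySet.of_add_right x.2 y.2 hxy)
    have ex : h.ap ((x : ℕ) : ZMod m) = x := h.apery_unique (h.ap_mem _) hx (h.ap_cast _)
    have ey : h.ap ((y : ℕ) : ZMod m) = y := h.apery_unique (h.ap_mem _) hy (h.ap_cast _)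
    rw [if_pos hx, if_pos hy, of_add_of, ex, ey]
    simp only [AddSubmonoid.coe_add, Nat.cast_add]
    refine if_congr ⟨fun hxy => ?_, fun e => ?_⟩ rfl rfl
    · exact h.apery_unique hxy (h.ap_mem _) (by rw [h.ap_cast, Nat.cast_add])
    · rw [e]; exact h.ap_mem _

variable {k : ℕ} {n : Fin k → ℕ}

open Classical in
lemma factHom_kunzAtoms (hn : ∀ i, n i ∈ aperySet S m) (w : Fin k → ℕ) :
    factHom (kunzAtoms h n) w =
      if factHom n w ∈ aperySet S m then of h (factHom n w : ZMod m) else ⊤ := by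
  have key : factHom (kunzAtoms h n) w = proj h (∑ i, w i • (⟨n i, (hn i).1⟩ : S)) := by
    rw [map_sum (proj h)]
    change ∑ i, w i • kunzAtoms h n i = _
    refine Finset.sum_congr rfl fun i _ => ?_
    rw [map_nsmul (proj h)]
    congr 1
    exact (if_pos (hn i)).symm
  have hval : ((∑ i, w i • (⟨n i, (hn i).1⟩ : S) : S) : ℕ) = factHom n w := by
    simp [factHom]
  rw [key]
  simp only [proj, AddMonoidHom.coe_mk, ZeroHom.coe_mk, hval]

lemma factHom_kunzAtoms_eq_top (hn : ∀ i, n i ∈ aperySet S m) {w : Fin k → ℕ} :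
    factHom (kunzAtoms h n) w = ⊤ ↔ factHom n w ∉ aperySet S m := by
  rw [factHom_kunzAtoms h hn]
  split_ifs with hw
  · simp [of_ne_top, hw]
  · simp [hw]

lemma factHom_kunzAtoms_congr (hn : ∀ i, n i ∈ aperySet S m) {w w' : Fin k → ℕ}
    (e : factHom n w = factHom n w') :
    factHom (kunzAtoms h n) w = factHom (kunzAtoms h n) w' := by
  rw [factHom_kunzAtoms h hn, factHom_kunzAtoms h hn, e]

lemma factHom_eq_of_kunzAtoms (hn : ∀ i, n i ∈ aperySet S m) {w w' : Fin k → ℕ}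
    (e : factHom (kunzAtoms h n) w = factHom (kunzAtoms h n) w')
    (hw : factHom (kunzAtoms h n) w ≠ ⊤) : factHom n w = factHom n w' := by
  have hw' := e ▸ hw
  rw [Ne, factHom_kunzAtoms_eq_top h hn, not_not] at hw hw'
  rw [factHom_kunzAtoms h hn, factHom_kunzAtoms h hn, if_pos hw, if_pos hw'] at e
  exact h.apery_unique hw hw' (of_injective h e)

end KunzNil

/-! ### The relations between factorizations of Apéry elements -/

section Main

variable {S : AddSubmonoid ℕ} {m k : ℕ} {n : Fin k → ℕ}
  {ρ : Set ((Fin (k + 1) → ℕ) × (Fin (k + 1) → ℕ))}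

lemma IsMCentric.factHom_hat_mem {h : IsNumerical S m} (hc : IsMCentric h n ρ)
    (hn : ∀ i, n i ∈ aperySet S m) {z z' : Fin (k + 1) → ℕ} (hz : (z, z') ∈ ρ) :
    factHom n (hat z) ∈ aperySet S m := by
  by_contra hne
  have h1 := (KunzNil.factHom_kunzAtoms_eq_top h hn).2 hne
  have h2 : factHom (kunzAtoms h n) (hat z) = KunzNil.of h _ := hc _ hz
  exact KunzNil.of_ne_top h _ (h2.symm.trans h1)

/-- The relations of `ρ` not involving `m` in their first entry, as relations over the atoms. -/
def aperyRelations (ρ : Set ((Fin (k + 1) → ℕ) × (Fin (k + 1) → ℕ))) :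
    Set ((Fin k → ℕ) × (Fin k → ℕ)) :=
  {r | ∃ z z', (z, z') ∈ ρ ∧ z 0 = 0 ∧ r = (hat z, hat z')}

lemma addConGen_aperyRelations (hgen : AddSubmonoid.closure (Set.range (gens m n)) = S)
    (hρ : IsPresentation (gens m n) ρ) {w w' : Fin k → ℕ} (hw : factHom n w ∈ aperySet S m)
    (e : factHom n w = factHom n w') :
    addConGen (fun v v' => (v, v') ∈ aperyRelations ρ) w w' := by
  have hS : ∀ z, factHom (gens m n) z ∈ S := fun z => (mem_iff_exists_factHom hgen).2 ⟨z, rfl⟩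
  have hcon := (isPresentation_iff.1 hρ (Fin.cons 0 w) (Fin.cons 0 w')).2 (by simpa using e)
  have key := AddCon.rel_of_addConGen
    (R := fun z z' => factHom (gens m n) z = factHom (gens m n) z' ∧
      (factHom (gens m n) z ∈ aperySet S m →
        addConGen (fun v v' => (v, v') ∈ aperyRelations ρ) (hat z) (hat z')))
    ⟨fun z => ⟨rfl, fun _ => AddCon.refl _ _⟩,
      fun h => ⟨h.1.symm, fun hz => AddCon.symm _ (h.2 (h.1 ▸ hz))⟩,
      fun h h' => ⟨h.1.trans h'.1, fun hz => AddCon.trans _ (h.2 hz) (h'.2 (h.1 ▸ hz))⟩⟩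
    (fun h h' => ⟨by rw [map_add, map_add, h.1, h'.1], fun hz => by
      rw [map_add] at hz
      exact AddCon.add _ (h.2 (aperySet.of_add_left (hS _) (hS _) hz))
        (h'.2 (aperySet.of_add_right (hS _) (hS _) hz))⟩)
    (fun z z' hz => ⟨hρ.factHom_eq hz, fun ha => addConGen_of_rel
      ⟨z, z', hz, apply_zero_eq_zero_of_mem_aperySet hgen ha, rfl⟩⟩) hcon
  simpa using key.2 (by simpa using hw)

lemma aperyRelations_spec {h : IsNumerical S m}
    (hgen : AddSubmonoid.closure (Set.range (gens m n)) = S)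
    (hn : ∀ i, n i ∈ aperySet S m) (hρ : IsPresentation (gens m n) ρ) (hc : IsMCentric h n ρ)
    {z z' : Fin (k + 1) → ℕ} (hz : (z, z') ∈ ρ) (h0 : z 0 = 0) :
    z' 0 = 0 ∧ factHom n (hat z) ∈ aperySet S m ∧ factHom n (hat z) = factHom n (hat z') := by
  have ha := hc.factHom_hat_mem hn hz
  have e := hρ.factHom_eq hz
  have e1 : factHom (gens m n) z = factHom n (hat z) := by simp [factHom_gens, h0]
  have h0' : z' 0 = 0 := apply_zero_eq_zero_of_mem_aperySet hgen (by rw [← e, e1]; exact ha)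
  refine ⟨h0', ha, ?_⟩
  rw [← e1, e]
  simp [factHom_gens, h0']

theorem isMinimalNilPresentation_aperyRelations {h : IsNumerical S m}
    (hgen : AddSubmonoid.closure (Set.range (gens m n)) = S)
    (hn : ∀ i, n i ∈ aperySet S m) (hρ : IsMinimalPresentation (gens m n) ρ)
    (hc : IsMCentric h n ρ) :
    IsMinimalNilPresentation (kunzAtoms h n) (aperyRelations ρ) := by
  rw [isMinimalPresentation_iff] at hρ
  obtain ⟨hρ, hirr⟩ := hρ
  set p := kunzAtoms h n with hp
  have hspec : ∀ r ∈ aperyRelations ρ, factHom p r.1 ≠ ⊤ ∧ factHom p r.1 = factHom p r.2 := by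
    rintro _ ⟨z, z', hz, h0, rfl⟩
    obtain ⟨-, ha, e⟩ := aperyRelations_spec hgen hn hρ hc hz h0
    exact ⟨fun ht => (KunzNil.factHom_kunzAtoms_eq_top h hn).1 ht ha,
      KunzNil.factHom_kunzAtoms_congr h hn e⟩
  obtain ⟨F₀, hF₀, hF₀t, hF₀g⟩ := exists_finite_generating_fiber p (KunzNil.top_add h)
  have hpres₀ : IsPresentation p (aperyRelations ρ ∪ F₀) := by
    refine isPresentation_iff.2 fun w w' => ⟨fun hw => ?_, fun e => ?_⟩
    · refine (AddCon.addConGen_le (c := AddCon.ker (factHom p))).2 (fun x y hxy => ?_) hw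
      rcases hxy with hxy | hxy
      · exact (hspec _ hxy).2
      · exact (hF₀t _ hxy).1.trans (hF₀t _ hxy).2.symm
    · by_cases ht : factHom p w = ⊤
      · exact addConGen_mono_rel (fun x y hxy => Or.inr hxy) (hF₀g w w' ht (e ▸ ht))
      · refine addConGen_mono_rel (fun x y hxy => Or.inl hxy)
          (addConGen_aperyRelations hgen hρ ?_ (KunzNil.factHom_eq_of_kunzAtoms h hn e ht))
        by_contra hne
        exact ht ((KunzNil.factHom_kunzAtoms_eq_top h hn).2 hne)
  obtain ⟨F, hF⟩ := (hF₀.finite_subsets.subset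
    (t := {F | F ⊆ F₀ ∧ IsPresentation p (aperyRelations ρ ∪ F)})
      fun F hF => hF.1).exists_minimal ⟨F₀, subset_rfl, hpres₀⟩
  obtain ⟨hFF₀, hpres⟩ := hF.prop
  have hFt : ∀ r ∈ F, factHom p r.1 = ⊤ := fun r hr => (hF₀t r (hFF₀ hr)).1
  refine ⟨aperyRelations ρ ∪ F, isMinimalPresentation_iff.2 ⟨hpres, ?_⟩, ?_⟩
  · rintro r (hr | hr) hcon
    · obtain ⟨z, z', hz, h0, rfl⟩ := hr
      have hsp := aperyRelations_spec hgen hn hρ hc hz h0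
      refine hirr _ hz ?_
      have key := AddCon.rel_of_addConGen
        (R := fun v v' => factHom p v = factHom p v' ∧ (factHom p v ≠ ⊤ →
          addConGen (fun y y' => (y, y') ∈ ρ \ {(z, z')})
            (Fin.cons 0 v : Fin (k + 1) → ℕ) (Fin.cons 0 v' : Fin (k + 1) → ℕ)))
        ⟨fun z => ⟨rfl, fun _ => AddCon.refl _ _⟩,
          fun h => ⟨h.1.symm, fun hz => AddCon.symm _ (h.2 (h.1 ▸ hz))⟩,
          fun h h' => ⟨h.1.trans h'.1, fun hz => AddCon.trans _ (h.2 hz) (h'.2 (h.1 ▸ hz))⟩⟩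
        (fun {v v' w w'} e e' => ⟨by rw [map_add, map_add, e.1, e'.1], fun hv => by
          rw [map_add] at hv
          rw [cons_zero_add, cons_zero_add]
          exact AddCon.add _ (e.2 fun ht => hv (by rw [ht, KunzNil.top_add]))
            (e'.2 fun ht => hv (by rw [ht, KunzNil.add_top]))⟩)
        (fun v v' hv => ⟨hpres.factHom_eq hv.1, fun ht => ?_⟩) hcon
      · have := key.2 (hspec _ ⟨z, z', hz, h0, rfl⟩).1
        simpa only [cons_hat h0, cons_hat hsp.1] using this
      · obtain ⟨hv1 | hv1, hv2⟩ := hv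
        · obtain ⟨y, y', hy, hy0, hvy⟩ := hv1
          obtain ⟨rfl, rfl⟩ := Prod.mk.inj hvy
          have hy0' := (aperyRelations_spec hgen hn hρ hc hy hy0).1
          rw [cons_hat hy0, cons_hat hy0']
          refine addConGen_of_rel ⟨hy, fun he => hv2 ?_⟩
          obtain ⟨rfl, rfl⟩ := Prod.mk.inj he
          rfl
        · exact absurd (hFt _ hv1) ht
    · refine (hF.le_of_le (y := F \ {r}) ⟨Set.sdiff_subset.trans hFF₀, ?_⟩ Set.sdiff_subset hr).2 rfl
      refine isPresentation_iff.2 fun w w' => ⟨fun hw => ?_, fun e => ?_⟩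
      · exact (isPresentation_iff.1 hpres w w').1 (addConGen_mono_rel
          (fun x y hxy => hxy.imp id And.left) hw)
      · refine AddCon.addConGen_le.2 (fun x y hxy => ?_) ((isPresentation_iff.1 hpres w w').2 e)
        by_cases hx : (x, y) = r
        · subst hx
          refine addConGen_mono_rel (fun x y hxy => ?_) hcon
          exact hxy.1.imp id fun hf => ⟨hf, hxy.2⟩
        · exact addConGen_of_rel (hxy.imp id fun hf => ⟨hf, hx⟩)
  · ext r
    refine ⟨fun hr => ⟨Or.inl hr, (hspec r hr).1⟩, ?_⟩
    rintro ⟨hr | hr, ht⟩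
    · exact hr
    · exact absurd (hFt r hr) ht

/-! ### Outer Betti elements as components of factorization graphs -/

/-- Two factorizations of the same integer which share a generator. -/
def SharesGen (n : Fin k → ℕ) (v v' : Fin k → ℕ) : Prop :=
  factHom n v = factHom n v' ∧ ∃ i, 0 < v i ∧ 0 < v' i

lemma IsOuterBetti.sharesGen {h : IsNumerical S m} (hn : ∀ i, n i ∈ aperySet S m)
    {B : Set (Fin k → ℕ)} (hB : IsOuterBetti (kunzAtoms h n) B) {v v' : Fin k → ℕ}
    (hv : v ∈ B) (hv' : v' ∈ B) (hvv' : ∃ i, 0 < v i ∧ 0 < v' i) : SharesGen n v v' := by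
  refine ⟨?_, hvv'⟩
  obtain ⟨i, hi, hi'⟩ := hvv'
  obtain ⟨x, hx, hsub⟩ := hB.sub_eq i ⟨v, hv, hi⟩
  obtain ⟨u, rfl⟩ := exists_eq_add_single hi
  obtain ⟨u', rfl⟩ := exists_eq_add_single hi'
  have hu : u ∈ factSet (kunzAtoms h n) x := hsub ▸ hv
  have hu' : u' ∈ factSet (kunzAtoms h n) x := hsub ▸ hv'
  rw [map_add, map_add, KunzNil.factHom_eq_of_kunzAtoms h hn (hu.trans hu'.symm)
    fun ht => hx (hu.symm.trans ht)]

lemma IsOuterBetti.mem_of_sharesGen {h : IsNumerical S m} (hn : ∀ i, n i ∈ aperySet S m)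
    {B : Set (Fin k → ℕ)} (hB : IsOuterBetti (kunzAtoms h n) B) {v v' : Fin k → ℕ}
    (hv : v ∈ B) (hvv' : SharesGen n v v') : v' ∈ B := by
  obtain ⟨e, i, hi, hi'⟩ := hvv'
  obtain ⟨x, hx, hsub⟩ := hB.sub_eq i ⟨v, hv, hi⟩
  obtain ⟨u, rfl⟩ := exists_eq_add_single hi
  obtain ⟨u', rfl⟩ := exists_eq_add_single hi'
  have hu : u ∈ factSet (kunzAtoms h n) x := hsub ▸ hv
  rw [map_add, map_add, add_left_inj] at e
  have hu' : u' ∈ factSet (kunzAtoms h n) x :=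
    (KunzNil.factHom_kunzAtoms_congr h hn e.symm).trans hu
  rw [← hsub] at hu'
  exact hu'

lemma IsOuterBetti.eq_component {h : IsNumerical S m} (hn : ∀ i, n i ∈ aperySet S m)
    {B : Set (Fin k → ℕ)} (hB : IsOuterBetti (kunzAtoms h n) B) {w : Fin k → ℕ} (hw : w ∈ B) :
    B = {v | Relation.ReflTransGen (SharesGen n) w v} := by
  ext v
  refine ⟨fun hv => ?_, fun hv => ?_⟩
  · have hr := (SimpleGraph.reachable_iff_reflTransGen _ _).1
      (hB.connected.preconnected ⟨w, hw⟩ ⟨v, hv⟩)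
    exact hr.lift (Subtype.val : B → Fin k → ℕ) fun a b hab => hB.sharesGen hn a.2 b.2 hab.2
  · induction hv with
    | refl => exact hw
    | tail _ hstep ih => exact hB.mem_of_sharesGen hn ih hstep

lemma factHom_eq_of_reflTransGen {w v : Fin k → ℕ}
    (h : Relation.ReflTransGen (SharesGen n) w v) : factHom n w = factHom n v := by
  induction h with
  | refl => rfl
  | tail _ hstep ih => exact ih.trans hstep.1

lemma IsPresentation.conBelow_of_reflTransGen (hρ : IsPresentation (gens m n) ρ)
    (hg : ∀ i, gens m n i ≠ 0) {w v : Fin k → ℕ}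
    (h : Relation.ReflTransGen (SharesGen n) w v) :
    conBelow (gens m n) ρ (factHom n w) (Fin.cons 0 w) (Fin.cons 0 v) := by
  induction h with
  | refl => exact AddCon.refl _ _
  | @tail u v hwu hstep ih =>
    refine AddCon.trans _ ih ?_
    obtain ⟨e, i, hi, hi'⟩ := hstep
    have := hρ.conBelow_of_pos hg (z := Fin.cons 0 u) (z' := Fin.cons 0 v) (by simpa using e)
      (i := i.succ) (by simpa using hi) (by simpa using hi')
    rwa [factHom_gens_cons_zero, ← factHom_eq_of_reflTransGen hwu] at this

lemma factGraph_component_connected (w : Fin k → ℕ) :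
    (factGraph {v | Relation.ReflTransGen (SharesGen n) w v}).Connected := by
  set B := {v | Relation.ReflTransGen (SharesGen n) w v}
  have hreach : ∀ v (hv : v ∈ B), (factGraph B).Reachable ⟨w, .refl⟩ ⟨v, hv⟩ := by
    intro v hv
    have hv' : Relation.ReflTransGen (SharesGen n) w v := hv
    induction hv' with
    | refl => exact SimpleGraph.Reachable.refl _
    | @tail u v hwu hstep ih =>
      refine (ih hwu).trans ?_
      by_cases huv : u = v
      · subst huv; exact SimpleGraph.Reachable.refl _
      · exact SimpleGraph.Adj.reachable ⟨fun e => huv (congrArg Subtype.val e), hstep.2⟩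
  exact { preconnected := fun a b => (hreach a.1 a.2).symm.trans (hreach b.1 b.2)
          nonempty := ⟨⟨w, .refl⟩⟩ }

/-- A component of a factorization graph is an outer Betti element as soon as none of its
generators occurs together with `m`. -/
lemma isOuterBetti_component {h : IsNumerical S m}
    (hgen : AddSubmonoid.closure (Set.range (gens m n)) = S)
    (hn : ∀ i, n i ∈ aperySet S m) {w : Fin k → ℕ} (hw : factHom n w ∉ aperySet S m)
    (hsep : ∀ v, Relation.ReflTransGen (SharesGen n) w v → ∀ i, 0 < v i →
      ∀ u : Fin (k + 1) → ℕ, factHom (gens m n) u = factHom n w → 0 < u 0 → u i.succ = 0) :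
    IsOuterBetti (kunzAtoms h n) {v | Relation.ReflTransGen (SharesGen n) w v} := by
  refine ⟨fun v hv => ?_, fun i ⟨v, hv, hi⟩ => ?_, factGraph_component_connected w⟩
  · refine (KunzNil.factHom_kunzAtoms_eq_top h hn).2 ?_
    rwa [← factHom_eq_of_reflTransGen hv]
  · obtain ⟨u, rfl⟩ := exists_eq_add_single hi
    have e := factHom_eq_of_reflTransGen hv
    have hu : factHom n u ∈ aperySet S m := by
      by_contra hne
      obtain ⟨y, hy, hy0⟩ := exists_factHom_eq_of_notMem_aperySet hgen (factHom_mem hgen u) hne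
      have := hsep _ hv i hi (y + Pi.single i.succ 1)
        (by rw [map_add, hy, factHom_single, e, map_add, factHom_single]; simp [gens])
        (by simpa using hy0)
      simp at this
    have hut : factHom (kunzAtoms h n) u ≠ ⊤ := fun ht =>
      (KunzNil.factHom_kunzAtoms_eq_top h hn).1 ht hu
    refine ⟨factHom (kunzAtoms h n) u, hut, ?_⟩
    ext x
    refine ⟨fun hx => ?_, fun hx => ?_⟩
    · have ex := e.symm.trans (factHom_eq_of_reflTransGen hx)
      rw [map_add, map_add, add_left_inj] at ex
      exact KunzNil.factHom_kunzAtoms_congr h hn ex.symm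
    · have ex := KunzNil.factHom_eq_of_kunzAtoms h hn (Eq.symm hx) hut
      exact Relation.ReflTransGen.tail hv
        ⟨by rw [map_add, map_add, ex], i, hi, by simp⟩

/-- The component of the second entry of a minimal relation whose first entry involves `m`. -/
lemma isOuterBetti_component_of_mem {h : IsNumerical S m}
    (hgen : AddSubmonoid.closure (Set.range (gens m n)) = S)
    (hn : ∀ i, n i ∈ aperySet S m) (hg : ∀ i, gens m n i ≠ 0)
    (hρ : IsMinimalPresentation (gens m n) ρ) {z z' : Fin (k + 1) → ℕ} (hz : (z, z') ∈ ρ)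
    (h0 : 0 < z 0) : z' 0 = 0 ∧
    IsOuterBetti (kunzAtoms h n) {v | Relation.ReflTransGen (SharesGen n) (hat z') v} := by
  obtain ⟨hρ, hirr⟩ := isMinimalPresentation_iff.1 hρ
  have e := hρ.factHom_eq hz
  have hnot : ¬ conBelow (gens m n) ρ (factHom (gens m n) z) z z' := fun hcon =>
    hirr _ hz (conBelow_sdiff le_rfl hcon)
  have h0' : z' 0 = 0 := by
    by_contra hne
    exact hnot (hρ.conBelow_of_pos hg e h0 (Nat.pos_of_ne_zero hne))
  have e' : factHom (gens m n) z = factHom n (hat z') := by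
    rw [e, factHom_gens, h0', zero_mul, zero_add]
  refine ⟨h0', isOuterBetti_component hgen hn (fun ha => ?_) fun v hv i hi u hu hu0 => ?_⟩
  · exact h0.ne' (apply_zero_eq_zero_of_mem_aperySet hgen (e' ▸ ha))
  · by_contra hne
    have h1 := hρ.conBelow_of_pos hg (e'.trans hu.symm) h0 hu0
    have h2 := hρ.conBelow_of_pos hg (z := u) (z' := Fin.cons 0 v)
      (by rw [hu, factHom_gens_cons_zero, factHom_eq_of_reflTransGen hv]) (i := i.succ)
      (Nat.pos_of_ne_zero hne) (by simpa using hi)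
    have h3 := hρ.conBelow_of_reflTransGen hg hv
    rw [cons_hat h0', ← e'] at h3
    rw [hu, ← e'] at h2
    exact hnot (AddCon.trans _ h1 (AddCon.trans _ h2 (AddCon.symm _ h3)))

/-- In each outer Betti element there is the second entry of some relation whose first entry
involves `m`. -/
lemma IsOuterBetti.exists_mem {h : IsNumerical S m}
    (hgen : AddSubmonoid.closure (Set.range (gens m n)) = S)
    (hn : ∀ i, n i ∈ aperySet S m) (hρ : IsPresentation (gens m n) ρ) (hc : IsMCentric h n ρ)
    {B : Set (Fin k → ℕ)} (hB : IsOuterBetti (kunzAtoms h n) B) :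
    ∃ z z', (z, z') ∈ ρ ∧ 0 < z 0 ∧ hat z' ∈ B := by
  by_contra! hno
  obtain ⟨⟨w, hw⟩⟩ := hB.connected.nonempty
  have hnotAp : ∀ v ∈ B, factHom n v ∉ aperySet S m := fun v hv =>
    (KunzNil.factHom_kunzAtoms_eq_top h hn).1 (hB.subset_nil hv)
  set C : Set (Fin (k + 1) → ℕ) := {z | z 0 = 0 ∧ hat z ∈ B} with hC
  have hclosed : ∀ z z', factHom (gens m n) z = factHom (gens m n) z' →
      (∃ i, 0 < z i ∧ 0 < z' i) → z ∈ C → z' ∈ C := by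
    rintro z z' e ⟨i, hi, hi'⟩ ⟨h0, hzB⟩
    cases i using Fin.cases with
    | zero => omega
    | succ j =>
      obtain ⟨x, hx, hsub⟩ := hB.sub_eq j ⟨hat z, hzB, hi⟩
      obtain ⟨u, hu⟩ := exists_eq_add_single (z := hat z) (i := j) hi
      obtain ⟨u', rfl⟩ := exists_eq_add_single hi'
      have huB : u ∈ factSet (kunzAtoms h n) x := by
        rw [← hsub]
        change u + Pi.single j 1 ∈ B
        rwa [← hu]
      have huA : factHom n u ∈ aperySet S m := by
        by_contra hne
        exact hx (huB.symm.trans ((KunzNil.factHom_kunzAtoms_eq_top h hn).2 hne))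
      have e1 : factHom n u = factHom (gens m n) u' := by
        rw [factHom_gens, h0, hu, map_add, map_add, factHom_single, factHom_single] at e
        simpa [gens] using e
      have h0' : u' 0 = 0 := apply_zero_eq_zero_of_mem_aperySet hgen (e1 ▸ huA)
      have h0'' : (u' + Pi.single j.succ 1 : Fin (k + 1) → ℕ) 0 = 0 := by simp [h0']
      refine ⟨h0'', hB.mem_of_sharesGen hn hzB ⟨?_, j, hi, hi'⟩⟩
      rw [factHom_gens, factHom_gens, h0, h0''] at e
      simpa using e
  have hshift : ∀ x y u, factHom (gens m n) x = factHom (gens m n) y → (x ∈ C ↔ y ∈ C) →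
      (x + u ∈ C ↔ y + u ∈ C) := by
    intro x y u e hxy
    by_cases hu : u = 0
    · simpa [hu] using hxy
    obtain ⟨i, hi⟩ := Function.ne_iff.1 hu
    have hi' : 0 < u i := Nat.pos_of_ne_zero hi
    have e' : factHom (gens m n) (x + u) = factHom (gens m n) (y + u) := by
      rw [map_add, map_add, e]
    have hx : 0 < (x + u) i := by simp only [Pi.add_apply]; omega
    have hy : 0 < (y + u) i := by simp only [Pi.add_apply]; omega
    exact ⟨hclosed _ _ e' ⟨i, hx, hy⟩, hclosed _ _ e'.symm ⟨i, hy, hx⟩⟩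
  obtain ⟨u, hu, hu0⟩ := exists_factHom_eq_of_notMem_aperySet hgen (factHom_mem hgen w)
    (hnotAp w hw)
  have hcon := (isPresentation_iff.1 hρ (Fin.cons 0 w) u).2 (by simpa using hu.symm)
  have key := AddCon.rel_of_addConGen
    (R := fun z z' => factHom (gens m n) z = factHom (gens m n) z' ∧ (z ∈ C ↔ z' ∈ C))
    ⟨fun z => ⟨rfl, Iff.rfl⟩, fun h => ⟨h.1.symm, h.2.symm⟩,
      fun h h' => ⟨h.1.trans h'.1, h.2.trans h'.2⟩⟩
    (fun {x y u v} e e' => ⟨by rw [map_add, map_add, e.1, e'.1],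
      (hshift x y u e.1 e.2).trans (by
        rw [add_comm y, add_comm y]; exact hshift u v y e'.1 e'.2)⟩)
    (fun z z' hz => ⟨hρ.factHom_eq hz, fun hzC => ?_, fun hzC => ?_⟩) hcon
  · exact hu0.ne' (key.2.1 ⟨rfl, by simpa using hw⟩).1
  · exact absurd (hc.factHom_hat_mem hn hz) (hnotAp _ hzC.2)
  · by_cases h0 : z 0 = 0
    · have := aperyRelations_spec hgen hn hρ hc hz h0
      exact absurd (this.2.2 ▸ this.2.1) (hnotAp _ hzC.2)
    · exact absurd hzC.2 (hno z z' hz (Nat.pos_of_ne_zero h0))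

end Main

theorem theorem5p9 (S : AddSubmonoid ℕ) (m k : ℕ) (h : IsNumerical S m) (n : Fin k → ℕ)
    (hgen : AddSubmonoid.closure (Set.range (gens m n)) = S)
    (hmin : ∀ i : Fin k, n i ∉ AddSubmonoid.closure (insert m (n '' {j | j ≠ i})))
    (ρ : Set ((Fin (k + 1) → ℕ) × (Fin (k + 1) → ℕ)))
    (hρ : IsMinimalPresentation (gens m n) ρ) (hc : IsMCentric h n ρ) :
    IsMinimalNilPresentation (kunzAtoms h n)
        {r | ∃ z z', (z, z') ∈ ρ ∧ z 0 = 0 ∧ r = (hat z, hat z')} ∧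
      (∀ w ∈ {w | ∃ z z', (z, z') ∈ ρ ∧ 0 < z 0 ∧ w = hat z'},
        ∃! B, IsOuterBetti (kunzAtoms h n) B ∧ w ∈ B) ∧
      (∀ B, IsOuterBetti (kunzAtoms h n) B →
        ∃! w, w ∈ {w | ∃ z z', (z, z') ∈ ρ ∧ 0 < z 0 ∧ w = hat z'} ∧ w ∈ B) := by
  have hn := gen_mem_aperySet h.ne_zero hgen hmin
  have hg := gens_ne_zero h.ne_zero (ne_zero_of_notMem_closure hmin)
  obtain ⟨hpres, hirr⟩ := isMinimalPresentation_iff.1 hρ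
  refine ⟨isMinimalNilPresentation_aperyRelations hgen hn hρ hc, ?_, fun B hB => ?_⟩
  · rintro _ ⟨z, z', hz, h0, rfl⟩
    exact ⟨_, ⟨(isOuterBetti_component_of_mem hgen hn hg hρ hz h0).2, .refl⟩,
      fun B hB => hB.1.eq_component hn hB.2⟩
  · obtain ⟨z, z', hz, h0, hzB⟩ := hB.exists_mem hgen hn hpres hc
    refine ⟨hat z', ⟨⟨z, z', hz, h0, rfl⟩, hzB⟩, ?_⟩
    rintro _ ⟨⟨y, y', hy, hy0, rfl⟩, hyB⟩
    by_contra hne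
    have hz0' := (isOuterBetti_component_of_mem (h := h) hgen hn hg hρ hz h0).1
    have hy0' := (isOuterBetti_component_of_mem (h := h) hgen hn hg hρ hy hy0).1
    have hpath : Relation.ReflTransGen (SharesGen n) (hat z') (hat y') := by
      rw [hB.eq_component hn hzB] at hyB; exact hyB
    have ez := hpres.factHom_eq hz
    have ey := hpres.factHom_eq hy
    have ez' : factHom (gens m n) z' = factHom n (hat z') := by simp [factHom_gens, hz0']
    have ey' : factHom (gens m n) y' = factHom n (hat y') := by simp [factHom_gens, hy0']
    have e : factHom (gens m n) z = factHom (gens m n) y := by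
      rw [ez, ez', factHom_eq_of_reflTransGen hpath, ← ey', ey]
    have h1 := conBelow_sdiff (r := (z, z')) le_rfl (hpres.conBelow_of_pos hg e h0 hy0)
    have h3 := conBelow_sdiff (r := (z, z')) (by rw [ez, ez'])
      (hpres.conBelow_of_reflTransGen hg hpath)
    rw [cons_hat hz0', cons_hat hy0'] at h3
    have h2 : addConGen (fun x x' => (x, x') ∈ ρ \ {(z, z')}) y y' :=
      addConGen_of_rel ⟨hy, fun he => hne (by rw [(Prod.mk.inj he).2])⟩
    exact hirr _ hz (AddCon.trans _ h1 (AddCon.trans _ h2 (AddCon.symm _ h3)))
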